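/- Let $N,r,s\ge 1$ be integers and let $A=(A_{k,l})_{k,l\ge 0}$ be an infinite band matrix with entries $A_{k,l}\in\mathbb C^{N\times N}$ such that $A_{k,l}=0$ whenever $l<k-s$ or $l>k+r$, and such that $A_{k,k+r}$ and $A_{k+s,k}$ are invertible for all $k\ge 0$. Let $\|\cdot\|$ be a norm on $\mathbb C^{N\times N}$ and suppose that $\sup_{k,l\ge 0}\|A_{k,l}\|<\infty$, so that $A$ generates a bounded linear operator, also denoted by $A$, on the Hilbert space $l^2_N$ of square summable sequences $u=(u_0,u_1,\dots)$ with $u_j\in\mathbb C^N$, by $(Au)_k=\sum_{l\ge 0}A_{k,l}u_l$. For $i=1,\dots,r$ let $(Q_k^{i}(\lambda))_{k\ge 0}$ be the sequence of polynomials in $\lambda$ with coefficients in $\mathbb C^{N\times N}$ determined by $$\sum_{l=0}^{k+r}A_{k,l}\,Q_l^{i}(\lambda)=\lambda\, Q_k^{i}(\lambda)\quad(k\ge 0),\qquad Q_k^{i}(\lambda)=\delta_{k,i-1}E\quad (0\le k<r),$$ and for $j=1,\dots,s$ let $(Q_k^{j,+}(\lambda))_{k\ge 0}$ be the sequence of polynomials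 in $\lambda$ with coefficients in $\mathbb C^{N\times N}$ determined by $$\sum_{l=0}^{k+s}Q_l^{j,+}(\lambda)\,A_{l,k}=\lambda\, Q_k^{j,+}(\lambda)\quad(k\ge 0),\qquad Q_k^{j,+}(\lambda)=\delta_{k,j-1}E\quad (0\le k<s),$$ where $E$ is the identity matrix of order $N$. If $\lambda\in\mathbb C$ belongs to the resolvent set of the operator $A$ (that is, $\lambda I-A$ has a bounded two-sided inverse on $l^2_N$), then $$\limsup_{k\to\infty}\|Q_k^{i}(\lambda)\|^{1/k}>1\quad(i=1,\dots,r),\qquad \limsup_{k\to\infty}\|Q_k^{j,+}(\lambda)\|^{1/k}>1\quad(j=1,\dots,s),$$ where the upper limits are taken in $[0,+\infty]$. -/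

import Mathlib

open Polynomial

/-- Square matrices of order `N` over `ℂ`, the entries of the band matrices. -/
abbrev Blk (N : ℕ) : Type := Matrix (Fin N) (Fin N) ℂ

/-- The Hilbert space `l²_N` of square summable sequences `u = (u₀, u₁, …)`, `u_j ∈ ℂ^N`. -/
abbrev L2N (N : ℕ) : Type := lp (fun _ : ℕ => EuclideanSpace ℂ (Fin N)) 2

/-- An infinite band matrix `(A_{k,l})`, `k, l ≥ 0`, with entries in `ℂ^{N × N}`, with `r` upper
and `s` lower diagonals, the extreme ones being made of invertible matrices. -/
structure BandMatrix (N r s : ℕ) where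
  entry : ℕ → ℕ → Blk N
  lower_zero : ∀ k l, l + s < k → entry k l = 0
  upper_zero : ∀ k l, k + r < l → entry k l = 0
  upper_isUnit : ∀ k, IsUnit (entry k (k + r))
  lower_isUnit : ∀ k, IsUnit (entry (k + s) k)

/-- On a finite dimensional space every linear map is bounded with respect to any norm `ν`. -/
theorem exists_bound_of_norm {V W : Type*} [AddCommGroup V] [Module ℂ V] [FiniteDimensional ℂ V]
    [NormedAddCommGroup W] [NormedSpace ℂ W] (ν : Seminorm ℂ V) (hν : ∀ v, ν v = 0 → v = 0)
    (f : V →ₗ[ℂ] W) : ∃ K : ℝ, 0 ≤ K ∧ ∀ v, ‖f v‖ ≤ K * ν v := by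
  let _ : Norm V := ⟨ν⟩
  have core : NormedSpace.Core ℂ V :=
    { norm_nonneg := fun v => apply_nonneg ν v
      norm_smul := fun c v => map_smul_eq_mul ν c v
      norm_triangle := fun v w => map_add_le_add ν v w
      norm_eq_zero_iff := fun v => ⟨hν v, fun h => by subst h; exact map_zero ν⟩ }
  let _ : NormedAddCommGroup V := NormedAddCommGroup.ofCore core
  let _ : NormedSpace ℂ V := NormedSpace.ofCore core
  exact ⟨‖LinearMap.toContinuousLinearMap f‖, norm_nonneg _,
    fun v => (LinearMap.toContinuousLinearMap f).le_opNorm v⟩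

namespace BandMatrix

variable {N r s : ℕ}

/-- The `k`-th component of `A u`, that is `∑_{l ≥ 0} A_{k,l} u_l`; the terms with `l > k + r`
vanish. -/
noncomputable def apply (A : BandMatrix N r s) (u : ℕ → EuclideanSpace ℂ (Fin N)) (k : ℕ) :
    EuclideanSpace ℂ (Fin N) :=
  ∑ l ∈ Finset.range (k + r + 1), Matrix.toEuclideanLin (A.entry k l) (u l)

theorem apply_eq_Icc (A : BandMatrix N r s) (u : ℕ → EuclideanSpace ℂ (Fin N)) (k : ℕ) :
    A.apply u k = ∑ l ∈ Finset.Icc (k - s) (k + r), Matrix.toEuclideanLin (A.entry k l) (u l) := by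
  unfold apply
  symm
  apply Finset.sum_subset
  · intro l hl
    simp only [Finset.mem_Icc, Finset.mem_range] at *
    omega
  · intro l hl hl'
    simp only [Finset.mem_Icc, Finset.mem_range] at *
    rw [A.lower_zero k l (by omega)]
    simp

theorem sum_sq_le (A : BandMatrix N r s) (D : ℝ)
    (h : ∀ k l v, ‖Matrix.toEuclideanLin (A.entry k l) v‖ ≤ D * ‖v‖)
    (u : ℕ → EuclideanSpace ℂ (Fin N)) (F : Finset ℕ) (B : ℝ)
    (hB : ∀ G : Finset ℕ, ∑ l ∈ G, ‖u l‖ ^ 2 ≤ B) :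
    ∑ k ∈ F, ‖A.apply u k‖ ^ 2 ≤ (D * (r + s + 1)) ^ 2 * B := by
  have h1 : ∀ k, ‖A.apply u k‖ ^ 2
      ≤ D ^ 2 * ((r + s + 1) * ∑ l ∈ Finset.Icc (k - s) (k + r), ‖u l‖ ^ 2) := by
    intro k
    have h2 : ‖A.apply u k‖ ≤ D * ∑ l ∈ Finset.Icc (k - s) (k + r), ‖u l‖ := by
      rw [apply_eq_Icc, Finset.mul_sum]
      exact norm_sum_le_of_le _ fun l _ => h k l (u l)
    have h3 : (∑ l ∈ Finset.Icc (k - s) (k + r), ‖u l‖) ^ 2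
        ≤ (r + s + 1) * ∑ l ∈ Finset.Icc (k - s) (k + r), ‖u l‖ ^ 2 := by
      refine sq_sum_le_card_mul_sum_sq.trans ?_
      refine mul_le_mul_of_nonneg_right ?_ (Finset.sum_nonneg fun _ _ => sq_nonneg _)
      rw [Nat.card_Icc]
      have : k + r + 1 - (k - s) ≤ r + s + 1 := by omega
      exact_mod_cast this
    calc ‖A.apply u k‖ ^ 2 ≤ (D * ∑ l ∈ Finset.Icc (k - s) (k + r), ‖u l‖) ^ 2 := by gcongr
      _ = D ^ 2 * (∑ l ∈ Finset.Icc (k - s) (k + r), ‖u l‖) ^ 2 := by ring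
      _ ≤ _ := by gcongr
  have h4 : ∑ k ∈ F, ∑ l ∈ Finset.Icc (k - s) (k + r), ‖u l‖ ^ 2 ≤ (r + s + 1) * B := by
    rw [Finset.sum_comm' (t' := F.biUnion fun k => Finset.Icc (k - s) (k + r))
      (s' := fun l => {k ∈ F | l ∈ Finset.Icc (k - s) (k + r)})]
    · calc _ ≤ ∑ l ∈ F.biUnion fun k => Finset.Icc (k - s) (k + r),
            ((r : ℝ) + s + 1) * ‖u l‖ ^ 2 := by
            refine Finset.sum_le_sum fun l _ => ?_
            rw [Finset.sum_const, nsmul_eq_mul]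
            refine mul_le_mul_of_nonneg_right ?_ (sq_nonneg _)
            have h5 : {k ∈ F | l ∈ Finset.Icc (k - s) (k + r)} ⊆ Finset.Icc (l - r) (l + s) := by
              intro k hk
              simp only [Finset.mem_filter, Finset.mem_Icc] at *
              omega
            have h6 := Finset.card_le_card h5
            rw [Nat.card_Icc] at h6
            have h7 := h6.trans (show l + s + 1 - (l - r) ≤ r + s + 1 by omega)
            exact_mod_cast h7
        _ = ((r : ℝ) + s + 1) * ∑ l ∈ F.biUnion fun k => Finset.Icc (k - s) (k + r),
            ‖u l‖ ^ 2 := by rw [Finset.mul_sum]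
        _ ≤ _ := by
            have := hB (F.biUnion fun k => Finset.Icc (k - s) (k + r))
            gcongr
    · intro k l
      simp only [Finset.mem_filter, Finset.mem_biUnion]
      tauto
  calc ∑ k ∈ F, ‖A.apply u k‖ ^ 2
      ≤ ∑ k ∈ F, D ^ 2 * ((r + s + 1) * ∑ l ∈ Finset.Icc (k - s) (k + r), ‖u l‖ ^ 2) :=
        Finset.sum_le_sum fun k _ => h1 k
    _ = D ^ 2 * ((r + s + 1) * ∑ k ∈ F, ∑ l ∈ Finset.Icc (k - s) (k + r), ‖u l‖ ^ 2) := by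
        rw [← Finset.mul_sum, ← Finset.mul_sum]
    _ ≤ D ^ 2 * ((r + s + 1) * ((r + s + 1) * B)) := by gcongr
    _ = _ := by ring

theorem entry_bound (A : BandMatrix N r s) (ν : Seminorm ℂ (Blk N)) (hν : ∀ M, ν M = 0 → M = 0)
    (hA : ∃ C : ℝ, ∀ k l, ν (A.entry k l) ≤ C) :
    ∃ D : ℝ, 0 ≤ D ∧ ∀ k l v, ‖Matrix.toEuclideanLin (A.entry k l) v‖ ≤ D * ‖v‖ := by
  obtain ⟨C, hC⟩ := hA
  have hC0 : 0 ≤ C := (apply_nonneg ν _).trans (hC 0 0)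
  obtain ⟨K, hK0, hK⟩ := exists_bound_of_norm ν hν
    ((LinearMap.toContinuousLinearMap (𝕜 := ℂ) (E := EuclideanSpace ℂ (Fin N))
      (F' := EuclideanSpace ℂ (Fin N))).toLinearMap ∘ₗ
      (Matrix.toEuclideanLin (𝕜 := ℂ) (m := Fin N) (n := Fin N)).toLinearMap)
  refine ⟨K * C, mul_nonneg hK0 hC0, fun k l v => ?_⟩
  have h1 := (LinearMap.toContinuousLinearMap (Matrix.toEuclideanLin (A.entry k l))).le_opNorm v
  refine h1.trans ?_
  refine mul_le_mul_of_nonneg_right ((hK (A.entry k l)).trans ?_) (norm_nonneg v)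
  exact mul_le_mul_of_nonneg_left (hC k l) hK0

theorem sum_sq_le_norm_sq (u : L2N N) (G : Finset ℕ) : ∑ l ∈ G, ‖u l‖ ^ 2 ≤ ‖u‖ ^ 2 := by
  have := lp.sum_rpow_le_norm_rpow (p := 2) (by norm_num) u G
  simpa using this

theorem memℓp_apply (A : BandMatrix N r s)
    (h : ∃ D : ℝ, 0 ≤ D ∧ ∀ k l v, ‖Matrix.toEuclideanLin (A.entry k l) v‖ ≤ D * ‖v‖)
    (u : L2N N) : Memℓp (A.apply u) 2 := by
  obtain ⟨D, hD, h⟩ := h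
  refine memℓp_gen' (C := (D * (r + s + 1)) ^ 2 * ‖u‖ ^ 2) fun F => ?_
  simpa using A.sum_sq_le D h u F _ (sum_sq_le_norm_sq u)

/-- The bounded linear operator on `l²_N` generated by a band matrix `A` whose entries are
uniformly bounded with respect to the matrix norm `ν`:
`(A u)_k = ∑_l A_{k,l} u_l`. -/
noncomputable def operator (A : BandMatrix N r s) (ν : Seminorm ℂ (Blk N))
    (hν : ∀ M, ν M = 0 → M = 0) (hA : ∃ C : ℝ, ∀ k l, ν (A.entry k l) ≤ C) :
    L2N N →L[ℂ] L2N N :=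
  LinearMap.mkContinuousOfExistsBound
    { toFun := fun u => ⟨A.apply u, A.memℓp_apply (A.entry_bound ν hν hA) u⟩
      map_add' := fun u v => by
        apply lp.ext
        funext k
        change A.apply (fun l => u l + v l) k = A.apply u k + A.apply v k
        simp [apply, Finset.sum_add_distrib]
      map_smul' := fun c u => by
        apply lp.ext
        funext k
        simp [apply, Finset.smul_sum] }
    (by
      obtain ⟨D, hD, h⟩ := A.entry_bound ν hν hA
      refine ⟨D * (r + s + 1), fun u => ?_⟩
      refine lp.norm_le_of_forall_sum_le (p := 2) (by norm_num) (by positivity) fun F => ?_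
      have := A.sum_sq_le D h u F _ (sum_sq_le_norm_sq u)
      rw [← mul_pow] at this
      simpa using this)

theorem operator_apply (A : BandMatrix N r s) (ν : Seminorm ℂ (Blk N))
    (hν : ∀ M, ν M = 0 → M = 0) (hA : ∃ C : ℝ, ∀ k l, ν (A.entry k l) ≤ C) (u : L2N N) (k : ℕ) :
    A.operator ν hν hA u k =
      ∑ l ∈ Finset.range (k + r + 1), Matrix.toEuclideanLin (A.entry k l) (u l) := rfl

/-- The `(k, l)` entry of `λ I - A`, a matrix polynomial in the indeterminate `λ`. -/
noncomputable def pencil (A : BandMatrix N r s) (k l : ℕ) : Matrix (Fin N) (Fin N) ℂ[X] :=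
  (if k = l then Matrix.scalar (Fin N) X else 0) - (A.entry k l).map C

/-- The matrix polynomials `Q_n^{i}(λ)`, `n ≥ 0` (with `i` counted from `0`): the solution of
`∑_l A_{k,l} Y_l = λ Y_k`, `k ≥ 0`, with `Y_i = E` and `Y_n = O` for the other `n < r`.
The solution is extended by `O` to `-s ≤ n < 0`, so the terms with negative `l` vanish. The
definition solves the equation number `n - r` for `Y_n`, its last term. -/
noncomputable def Q (A : BandMatrix N r s) (i : Fin r) : ℕ → Matrix (Fin N) (Fin N) ℂ[X]
  | n =>
    if n < r then (if n = i then 1 else 0)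
    else ((A.entry (n - r) n)⁻¹).map C * ∑ l : Fin n, A.pencil (n - r) l * Q A i l
  termination_by n => n
  decreasing_by exact l.2

/-- The matrix polynomials `Q_n^{j,+}(λ)`, `n ≥ 0` (with `j` counted from `0`): the solution of
the dual equation `∑_l Y_l A_{l,k} = λ Y_k`, `k ≥ 0`, with `Y_j = E` and `Y_n = O` for the other
`n < s`; it is extended by `O` to `-r ≤ n < 0`. -/
noncomputable def Qplus (A : BandMatrix N r s) (j : Fin s) : ℕ → Matrix (Fin N) (Fin N) ℂ[X]
  | n =>
    if n < s then (if n = j then 1 else 0)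
    else (∑ l : Fin n, Qplus A j l * A.pencil l (n - s)) * ((A.entry n (n - s))⁻¹).map C
  termination_by n => n
  decreasing_by exact l.2

/-- The value `Q_n^{i}(z)` at `z`, a complex matrix. -/
noncomputable def Qval (A : BandMatrix N r s) (i : Fin r) (n : ℕ) (z : ℂ) : Blk N :=
  (A.Q i n).map (eval z)

/-- The value `Q_n^{j,+}(z)` at `z`, a complex matrix. -/
noncomputable def QplusVal (A : BandMatrix N r s) (j : Fin s) (n : ℕ) (z : ℂ) : Blk N :=
  (A.Qplus j n).map (eval z)

theorem mapMatrix_C (M : Blk N) (z : ℂ) : (evalRingHom z).mapMatrix (M.map C) = M := by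
  ext a b
  simp

theorem mapMatrix_pencil (A : BandMatrix N r s) (k l : ℕ) (z : ℂ) :
    (evalRingHom z).mapMatrix (A.pencil k l) = (if k = l then z • 1 else 0) - A.entry k l := by
  rw [pencil, map_sub, mapMatrix_C]
  congr 1
  split_ifs
  · ext a b
    by_cases h : a = b <;> simp [Matrix.scalar_apply, h]
  · simp

theorem Qval_init (A : BandMatrix N r s) (i : Fin r) (n : ℕ) (z : ℂ) (hn : n < r) :
    A.Qval i n z = if n = i then 1 else 0 := by
  change (evalRingHom z).mapMatrix (A.Q i n) = _
  rw [Q, if_pos hn]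
  split_ifs <;> simp

theorem QplusVal_init (A : BandMatrix N r s) (j : Fin s) (n : ℕ) (z : ℂ) (hn : n < s) :
    A.QplusVal j n z = if n = j then 1 else 0 := by
  change (evalRingHom z).mapMatrix (A.Qplus j n) = _
  rw [Qplus, if_pos hn]
  split_ifs <;> simp

/-- `Q^{i}(z)` solves the difference equation. -/
theorem Qval_rec (A : BandMatrix N r s) (i : Fin r) (k : ℕ) (z : ℂ) :
    ∑ l ∈ Finset.range (k + r + 1), A.entry k l * A.Qval i l z = z • A.Qval i k z := by
  have hr : 0 < r := i.pos
  have hu := (Matrix.isUnit_iff_isUnit_det _).1 (A.upper_isUnit k)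
  have h : A.Qval i (k + r) z = (A.entry k (k + r))⁻¹ * ∑ l ∈ Finset.range (k + r),
      ((if k = l then z • 1 else 0) - A.entry k l) * A.Qval i l z := by
    change (evalRingHom z).mapMatrix (A.Q i (k + r)) = _
    rw [Q, if_neg (by omega), map_mul, mapMatrix_C, map_sum, Nat.add_sub_cancel,
      ← Fin.sum_univ_eq_sum_range
        (fun l => ((if k = l then z • 1 else 0) - A.entry k l) * A.Qval i l z)]
    simp only [map_mul, mapMatrix_pencil]
    rfl
  rw [Finset.sum_range_succ, h, ← mul_assoc, Matrix.mul_nonsing_inv _ hu, one_mul]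
  simp only [sub_mul, Finset.sum_sub_distrib, ite_mul, zero_mul, Finset.sum_ite_eq,
    Finset.mem_range]
  rw [if_pos (by omega)]
  simp

/-- `Q^{j,+}(z)` solves the dual difference equation. -/
theorem QplusVal_rec (A : BandMatrix N r s) (j : Fin s) (k : ℕ) (z : ℂ) :
    ∑ l ∈ Finset.range (k + s + 1), A.QplusVal j l z * A.entry l k = z • A.QplusVal j k z := by
  have hs : 0 < s := j.pos
  have hu := (Matrix.isUnit_iff_isUnit_det _).1 (A.lower_isUnit k)
  have h : A.QplusVal j (k + s) z = (∑ l ∈ Finset.range (k + s),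
      A.QplusVal j l z * ((if l = k then z • 1 else 0) - A.entry l k)) *
        (A.entry (k + s) k)⁻¹ := by
    change (evalRingHom z).mapMatrix (A.Qplus j (k + s)) = _
    rw [Qplus, if_neg (by omega), map_mul, mapMatrix_C, map_sum, Nat.add_sub_cancel,
      ← Fin.sum_univ_eq_sum_range
        (fun l => A.QplusVal j l z * ((if l = k then z • 1 else 0) - A.entry l k))]
    simp only [map_mul, mapMatrix_pencil]
    rfl
  rw [Finset.sum_range_succ, h, mul_assoc, Matrix.nonsing_inv_mul _ hu, mul_one]
  simp only [mul_sub, Finset.sum_sub_distrib, mul_ite, mul_zero, Finset.sum_ite_eq',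
    Finset.mem_range]
  rw [if_pos (by omega)]
  simp

end BandMatrix

/-! Conjugating `A` formally by the diagonal `t ^ k` multiplies the block `(k, l)` by `t ^ (k - l)`.
Only the finitely many differences in `[-r, s]` occur, so for `t` near `1` the resulting operator
`B` is norm-close to `A`; invertible operators form an open set, so `z - B` is still invertible
(`eventually_isUnit_conj`).

Suppose a limsup is at most `1`. For `q < 1` near `1` and a vector `c ≠ 0`, the sequence `q ^ k Q_k
c` is square summable (`memℓp_of_limsup_le_one`), and the recurrence puts it in the kernel of `z -
B` with `t = q`. Its entry at the initial index is a nonzero multiple of `c`, a contradiction.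
Dually, for `t > 1` the vectors `t ^ (-k) (Q_k^+)^* c` form an `ℓ²` element orthogonal to the range
of `z - B`, hence in the kernel of an invertible adjoint. -/

theorem eq_zero_of_isUnit {H : Type*} [NormedAddCommGroup H] [NormedSpace ℂ H] {T : H →L[ℂ] H}
    (hT : IsUnit T) {u : H} (hu : T u = 0) : u = 0 := by
  obtain ⟨U, rfl⟩ := hT
  have h : ((↑U⁻¹ : H →L[ℂ] H) * ↑U) u = 0 := by
    rw [mul_apply_eq_comp, hu, map_zero]
  rwa [Units.inv_mul] at h

theorem eq_zero_of_isUnit_adjoint {H : Type*} [NormedAddCommGroup H] [InnerProductSpace ℂ H]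
    [CompleteSpace H] {T : H →L[ℂ] H} (hT : IsUnit T) {u : H}
    (hu : ContinuousLinearMap.adjoint T u = 0) : u = 0 :=
  eq_zero_of_isUnit hT.star hu

theorem algebraMap_sub_apply {H : Type*} [NormedAddCommGroup H] [NormedSpace ℂ H] (z : ℂ)
    (T : H →L[ℂ] H) (u : H) : (algebraMap ℂ (H →L[ℂ] H) z - T) u = z • u - T u :=
  rfl

/-! ### Perturbation by geometric conjugation -/

namespace BandMatrix

variable {N r s : ℕ}

/-- The band matrix with entries `f (k - l) • A_{k,l}`. -/
def twist (A : BandMatrix N r s) (f : ℤ → ℂ) (hr : f (-r) ≠ 0) (hs : f s ≠ 0) :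
    BandMatrix N r s where
  entry k l := f (k - l) • A.entry k l
  lower_zero k l h := by rw [A.lower_zero k l h, smul_zero]
  upper_zero k l h := by rw [A.upper_zero k l h, smul_zero]
  upper_isUnit k := by
    have h : ((k : ℤ) - ((k + r : ℕ) : ℤ)) = -r := by push_cast; ring
    rw [h]
    exact (A.upper_isUnit k).smul (Units.mk0 _ hr)
  lower_isUnit k := by
    have h : (((k + s : ℕ) : ℤ) - (k : ℤ)) = s := by push_cast; ring
    rw [h]
    exact (A.lower_isUnit k).smul (Units.mk0 _ hs)

/-- Only the values of `f` on `[-r, s]` matter for the size of the entries of a twist. -/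
theorem twist_entry_bound {E : Type*} [AddCommGroup E] [Module ℂ E] (p : Seminorm ℂ E)
    (A : BandMatrix N r s) (f : ℤ → ℂ) (hr : f (-r) ≠ 0) (hs : f s ≠ 0) (g : Blk N →ₗ[ℂ] E)
    {C ε : ℝ} (hε : 0 ≤ ε) (hC0 : 0 ≤ C) (hf : ∀ n ∈ Finset.Icc (-r : ℤ) s, ‖f n‖ ≤ ε) (k l : ℕ)
    (hC : p (g (A.entry k l)) ≤ C) : p (g ((A.twist f hr hs).entry k l)) ≤ ε * C := by
  change p (g (f (k - l) • A.entry k l)) ≤ ε * C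
  by_cases h1 : l + s < k
  · rw [A.lower_zero k l h1, smul_zero, map_zero, map_zero]
    positivity
  by_cases h2 : k + r < l
  · rw [A.upper_zero k l h2, smul_zero, map_zero, map_zero]
    positivity
  rw [map_smul, map_smul_eq_mul]
  have := hf (k - l) (Finset.mem_Icc.2 ⟨by omega, by omega⟩)
  gcongr

/-- A band of width `r + s + 1` has at most that many nonzero blocks in each row and column. This
turns blockwise smallness into operator smallness. -/
theorem norm_operator_le (A : BandMatrix N r s) (ν : Seminorm ℂ (Blk N))
    (hν : ∀ M, ν M = 0 → M = 0) (hA : ∃ C : ℝ, ∀ k l, ν (A.entry k l) ≤ C) {D : ℝ} (hD : 0 ≤ D)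
    (h : ∀ k l v, ‖Matrix.toEuclideanLin (A.entry k l) v‖ ≤ D * ‖v‖) :
    ‖A.operator ν hν hA‖ ≤ D * (r + s + 1) := by
  refine ContinuousLinearMap.opNorm_le_bound _ (by positivity) fun u => ?_
  refine lp.norm_le_of_forall_sum_le (p := 2) (by norm_num) (by positivity) fun F => ?_
  have := A.sum_sq_le D h u F _ (sum_sq_le_norm_sq u)
  rw [← mul_pow] at this
  simp only [ENNReal.toReal_ofNat, Real.rpow_ofNat]
  exact this

/-- Invertibility of `z - A` is stable under the conjugation `A_{k,l} ↦ t^{k-l} A_{k,l}` for `t`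
close to `1`. -/
theorem eventually_isUnit_conj (hr : 1 ≤ r) (hs : 1 ≤ s) (A : BandMatrix N r s)
    (ν : Seminorm ℂ (Blk N)) (hν : ∀ M, ν M = 0 → M = 0)
    (hA : ∃ C : ℝ, ∀ k l, ν (A.entry k l) ≤ C) (z : ℂ)
    (hz : z ∈ resolventSet ℂ (A.operator ν hν hA)) :
    ∀ᶠ t : ℝ in nhds 1, 0 < t → t ≠ 1 → ∃ B : L2N N →L[ℂ] L2N N,
      (∀ u k, B u k = ∑ l ∈ Finset.range (k + r + 1),
        (t : ℂ) ^ ((k : ℤ) - l) • Matrix.toEuclideanLin (A.entry k l) (u l)) ∧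
      IsUnit (algebraMap ℂ (L2N N →L[ℂ] L2N N) z - B) := by
  obtain ⟨D, hD, hDA⟩ := A.entry_bound ν hν hA
  have hopen := Units.isOpen.mem_nhds (spectrum.mem_resolventSet_iff.1 hz)
  obtain ⟨δ, hδ, hball⟩ := Metric.mem_nhds_iff.1 hopen
  -- Makes the perturbation bound `ε * D * (r + s + 1)` less than `δ`; the `+ 1` covers `D = 0`.
  set ε : ℝ := δ / 2 / (D * (r + s + 1) + 1) with hεdef
  have hε : 0 < ε := by positivity
  have hev : ∀ᶠ t : ℝ in nhds 1, ∀ n ∈ Finset.Icc (-r : ℤ) s, ‖(t : ℂ) ^ n - 1‖ ≤ ε := by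
    rw [Filter.eventually_all_finset]
    intro n _
    have hc : ContinuousAt (fun t : ℝ => ‖(t : ℂ) ^ n - 1‖) 1 :=
      (((Complex.continuous_ofReal.continuousAt).zpow₀ n (Or.inl (by simp))).sub
        continuousAt_const).norm
    have h0 : (fun t : ℝ => ‖(t : ℂ) ^ n - 1‖) 1 < ε := by simpa using hε
    filter_upwards [hc.eventually_lt continuousAt_const h0] with t ht using ht.le
  filter_upwards [hev] with t ht ht0 ht1
  -- The difference `B - A` has multipliers `t ^ n - 1`; they must not vanish at `n = -r` and `n =
  -- s`, so that its extreme diagonals stay invertible.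
  have hne : ∀ n : ℤ, n ≠ 0 → (t : ℂ) ^ n - 1 ≠ 0 := by
    intro n hn h
    rw [sub_eq_zero] at h
    have h' : t ^ n = 1 := by exact_mod_cast h
    rcases (zpow_eq_one_iff_of_ne_zero₀ hn).1 h' with h | h
    · exact ht1 h
    · linarith [h.1]
  have h1 : (fun n : ℤ => (t : ℂ) ^ n - 1) (-r) ≠ 0 := hne _ (by omega)
  have h2 : (fun n : ℤ => (t : ℂ) ^ n - 1) s ≠ 0 := hne _ (by omega)
  set T := A.twist (fun n : ℤ => (t : ℂ) ^ n - 1) h1 h2 with hT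
  have hTA : ∃ C : ℝ, ∀ k l, ν (T.entry k l) ≤ C := by
    obtain ⟨C, hC⟩ := hA
    exact ⟨ε * C, fun k l => A.twist_entry_bound ν _ h1 h2 LinearMap.id hε.le
      ((apply_nonneg ν _).trans (hC 0 0)) ht k l (hC k l)⟩
  refine ⟨A.operator ν hν hA + T.operator ν hν hTA, fun u k => ?_, hball ?_⟩
  · change A.operator ν hν hA u k + T.operator ν hν hTA u k = _
    rw [operator_apply, operator_apply, ← Finset.sum_add_distrib]
    refine Finset.sum_congr rfl fun l _ => ?_
    rw [hT]
    simp only [twist, sub_smul, one_smul, map_sub, map_smul, LinearMap.sub_apply,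
      LinearMap.smul_apply, add_sub_cancel]
  · rw [Metric.mem_ball, dist_eq_norm, sub_sub_sub_cancel_left, sub_add_cancel_left, norm_neg]
    have h3 := T.norm_operator_le ν hν hTA (D := ε * D) (by positivity) fun k l v => by
      have := A.twist_entry_bound (normSeminorm ℂ _) _ h1 h2
        ((LinearMap.applyₗ v).comp (Matrix.toEuclideanLin (𝕜 := ℂ)).toLinearMap) hε.le
        (C := D * ‖v‖) (by positivity) ht k l (hDA k l v)
      rw [mul_assoc]
      exact this
    have h4 : ε * (D * (r + s + 1) + 1) = δ / 2 := by
      rw [hεdef]; field_simp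
    nlinarith

/-- A sequence with root growth at most `1` becomes square summable after geometric damping. -/
theorem memℓp_of_limsup_le_one (ν : Seminorm ℂ (Blk N)) {M : ℕ → Blk N}
    (hM : Filter.limsup
      (fun k : ℕ => ENNReal.ofReal (ν (M k)) ^ (1 / (k : ℝ))) Filter.atTop ≤ 1)
    {q K : ℝ} (hq0 : 0 < q) (hq1 : q < 1) {u : ℕ → EuclideanSpace ℂ (Fin N)}
    (hu : ∀ k, ‖u k‖ ≤ q ^ k * (K * ν (M k))) : Memℓp u 2 := by
  -- The damping `q ^ k = p ^ k * p ^ k` is shared: one factor absorbs growth up to `p⁻¹ ^ k`, the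
  -- other leaves geometric decay.
  set p := Real.sqrt q with hp
  have hp0 : 0 < p := Real.sqrt_pos.2 hq0
  have hpq : p * p = q := Real.mul_self_sqrt hq0.le
  have hp1 : p < 1 := by nlinarith
  have hlt : Filter.limsup
      (fun k : ℕ => ENNReal.ofReal (ν (M k)) ^ (1 / (k : ℝ))) Filter.atTop
      < ENNReal.ofReal p⁻¹ :=
    hM.trans_lt (by rw [← ENNReal.ofReal_one]
                    exact (ENNReal.ofReal_lt_ofReal_iff (by positivity)).2
                      ((one_lt_inv₀ hp0).2 hp1))
  have hev : ∀ᶠ k : ℕ in Filter.atTop, ν (M k) ≤ (p⁻¹) ^ k := by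
    -- At `k = 0` the exponent `1 / k` is `0` and the root cannot be undone.
    filter_upwards [Filter.eventually_lt_of_limsup_lt hlt,
      Filter.eventually_ge_atTop 1] with k hk hk1
    have hk0 : (0 : ℝ) < k := by exact_mod_cast hk1
    have h1 := ENNReal.rpow_lt_rpow hk hk0
    rw [← ENNReal.rpow_mul, one_div, inv_mul_cancel₀ hk0.ne', ENNReal.rpow_one,
      ENNReal.rpow_natCast, ← ENNReal.ofReal_pow (by positivity)] at h1
    exact (ENNReal.ofReal_lt_ofReal_iff (by positivity)).1 h1 |>.le
  refine memℓp_gen ?_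
  have hs : Summable fun k : ℕ => |K| ^ 2 * q ^ k :=
    (summable_geometric_of_lt_one hq0.le hq1).mul_left _
  refine Summable.of_norm_bounded_eventually_nat hs ?_
  filter_upwards [hev] with k hk
  have h1 : ‖u k‖ ≤ |K| * p ^ k := by
    calc ‖u k‖ ≤ q ^ k * (K * ν (M k)) := hu k
      _ ≤ q ^ k * (|K| * (p⁻¹) ^ k) := by
        have := apply_nonneg ν (M k)
        gcongr
        exact le_abs_self K
      _ = |K| * p ^ k := by
        rw [← hpq, mul_pow, inv_pow]
        field_simp
  have h2 : ‖u k‖ ^ 2 ≤ (|K| * p ^ k) ^ 2 := by gcongr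
  have h3 : (|K| * p ^ k) ^ 2 = |K| ^ 2 * q ^ k := by
    rw [← hpq]; ring
  rw [h3] at h2
  simpa using h2

theorem exists_toEuclideanCLM_bound (ν : Seminorm ℂ (Blk N)) (hν : ∀ M, ν M = 0 → M = 0) :
    ∃ K : ℝ, 0 ≤ K ∧
      ∀ M : Blk N, ‖Matrix.toEuclideanCLM (n := Fin N) (𝕜 := ℂ) M‖ ≤ K * ν M :=
  exists_bound_of_norm ν hν
    (Matrix.toEuclideanCLM (n := Fin N) (𝕜 := ℂ)).toAlgEquiv.toLinearMap

/-! ### Kernel vectors from slowly growing solutions -/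

theorem one_lt_limsup_Qval (hN : 1 ≤ N) (hr : 1 ≤ r) (hs : 1 ≤ s) (A : BandMatrix N r s)
    (ν : Seminorm ℂ (Blk N)) (hν : ∀ M, ν M = 0 → M = 0)
    (hA : ∃ C : ℝ, ∀ k l, ν (A.entry k l) ≤ C)
    (z : ℂ) (hz : z ∈ resolventSet ℂ (A.operator ν hν hA)) (i : Fin r) :
    1 < Filter.limsup
      (fun k : ℕ => ENNReal.ofReal (ν (A.Qval i k z)) ^ (1 / (k : ℝ))) Filter.atTop := by
  by_contra hle
  rw [not_lt] at hle
  obtain ⟨q, ⟨hq0, hq1⟩, hq⟩ := ((show ∀ᶠ q : ℝ in nhdsWithin 1 (Set.Iio 1), q ∈ Set.Ioo (0 : ℝ) 1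
    from Ioo_mem_nhdsLT zero_lt_one).and
    ((A.eventually_isUnit_conj hr hs ν hν hA z hz).filter_mono nhdsWithin_le_nhds)).exists
  obtain ⟨B, hB, hunit⟩ := hq hq0 hq1.ne
  obtain ⟨K, hK0, hK⟩ := exists_toEuclideanCLM_bound ν hν
  have : Nonempty (Fin N) := ⟨⟨0, hN⟩⟩
  obtain ⟨c, hc⟩ := exists_ne (0 : EuclideanSpace ℂ (Fin N))
  have hqC : (q : ℂ) ≠ 0 := by exact_mod_cast hq0.ne'
  let u : L2N N := ⟨fun k => (q : ℂ) ^ k • Matrix.toEuclideanLin (A.Qval i k z) c,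
    memℓp_of_limsup_le_one ν hle hq0 hq1 (K := K * ‖c‖) fun k => by
      rw [norm_smul, norm_pow, Complex.norm_real, Real.norm_of_nonneg hq0.le]
      gcongr
      have := (Matrix.toEuclideanCLM (n := Fin N) (𝕜 := ℂ) (A.Qval i k z)).le_opNorm c
      have h2 := mul_le_mul_of_nonneg_right (hK (A.Qval i k z)) (norm_nonneg c)
      exact (this.trans h2).trans (by linarith)⟩
  have hu : ∀ k, u k = (q : ℂ) ^ k • Matrix.toEuclideanLin (A.Qval i k z) c := fun _ => rfl
  have hker : (algebraMap ℂ (L2N N →L[ℂ] L2N N) z - B) u = 0 := by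
    apply lp.ext
    funext k
    rw [algebraMap_sub_apply, lp.coeFn_sub, Pi.sub_apply, lp.coeFn_zero, Pi.zero_apply,
      hB, sub_eq_zero, lp.coeFn_smul, Pi.smul_apply]
    -- The weights combine as `q ^ (k - l) * q ^ l = q ^ k`, which reduces the kernel equation to
    -- the recurrence.
    have h1 := congrArg (fun M => (q : ℂ) ^ k • Matrix.toEuclideanLin M c) (A.Qval_rec i k z)
    simp only [map_sum, map_smul, LinearMap.sum_apply, LinearMap.smul_apply,
      Finset.smul_sum] at h1
    rw [hu, smul_comm, ← h1]
    refine Finset.sum_congr rfl fun l _ => ?_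
    rw [hu, map_smul, smul_smul, ← zpow_natCast, ← zpow_natCast, ← zpow_add₀ hqC, sub_add_cancel,
      Matrix.toLpLin_mul_same]
    rfl
  have hu0 : u = 0 := eq_zero_of_isUnit hunit hker
  have h1 := hu i
  rw [hu0, Qval_init A i i z i.2, if_pos rfl] at h1
  have h2 : (q : ℂ) ^ (i : ℕ) • c = 0 := by
    simpa using h1.symm
  exact (smul_ne_zero (pow_ne_zero _ hqC) hc) h2

theorem one_lt_limsup_QplusVal (hN : 1 ≤ N) (hr : 1 ≤ r) (hs : 1 ≤ s) (A : BandMatrix N r s)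
    (ν : Seminorm ℂ (Blk N)) (hν : ∀ M, ν M = 0 → M = 0)
    (hA : ∃ C : ℝ, ∀ k l, ν (A.entry k l) ≤ C)
    (z : ℂ) (hz : z ∈ resolventSet ℂ (A.operator ν hν hA)) (j : Fin s) :
    1 < Filter.limsup
      (fun k : ℕ => ENNReal.ofReal (ν (A.QplusVal j k z)) ^ (1 / (k : ℝ))) Filter.atTop := by
  by_contra hle
  rw [not_lt] at hle
  -- Left solutions acquire the weight `t ^ (-k)`, so damping now requires `t > 1`.
  obtain ⟨t, ht1, ht⟩ := ((show ∀ᶠ t : ℝ in nhdsWithin 1 (Set.Ioi 1), t ∈ Set.Ioi (1 : ℝ)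
    from self_mem_nhdsWithin).and
    ((A.eventually_isUnit_conj hr hs ν hν hA z hz).filter_mono nhdsWithin_le_nhds)).exists
  have ht1 : 1 < t := ht1
  have ht0 : 0 < t := by linarith
  obtain ⟨B, hB, hunit⟩ := ht ht0 ht1.ne'
  obtain ⟨K, hK0, hK⟩ := exists_toEuclideanCLM_bound ν hν
  have : Nonempty (Fin N) := ⟨⟨0, hN⟩⟩
  obtain ⟨c, hc⟩ := exists_ne (0 : EuclideanSpace ℂ (Fin N))
  have htC : (t : ℂ) ≠ 0 := by exact_mod_cast ht0.ne'
  let S : ℕ → (EuclideanSpace ℂ (Fin N) →L[ℂ] EuclideanSpace ℂ (Fin N)) := fun k =>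
    Matrix.toEuclideanCLM (n := Fin N) (𝕜 := ℂ) (A.QplusVal j k z)
  let x : L2N N := ⟨fun k => ((t⁻¹ : ℝ) : ℂ) ^ k • ContinuousLinearMap.adjoint (S k) c,
    memℓp_of_limsup_le_one ν hle (inv_pos.2 ht0) (inv_lt_one_of_one_lt₀ ht1) (K := K * ‖c‖)
      fun k => by
        rw [norm_smul, norm_pow, Complex.norm_real, Real.norm_of_nonneg (inv_pos.2 ht0).le]
        gcongr
        have := (ContinuousLinearMap.adjoint (S k)).le_opNorm c
        rw [LinearIsometryEquiv.norm_map] at this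
        have h2 := mul_le_mul_of_nonneg_right (hK (A.QplusVal j k z)) (norm_nonneg c)
        exact (this.trans h2).trans (by linarith)⟩
  have hx : ∀ k v, inner ℂ (x k) v = (t : ℂ) ^ (-(k : ℤ)) *
      inner ℂ c (Matrix.toEuclideanLin (A.QplusVal j k z) v) := fun k v => by
    change inner ℂ (((t⁻¹ : ℝ) : ℂ) ^ k • ContinuousLinearMap.adjoint (S k) c) v = _
    rw [inner_smul_left, ContinuousLinearMap.adjoint_inner_left, map_pow, Complex.conj_ofReal,
      Complex.ofReal_inv, inv_pow, zpow_neg, zpow_natCast]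
    rfl
  -- Since `t ^ (-l) * t ^ (l - k)` does not depend on `l`, column `k` of the pairing is the dual
  -- recurrence.
  have horth : ∀ k v,
      inner ℂ x ((algebraMap ℂ (L2N N →L[ℂ] L2N N) z - B) (lp.single 2 k v)) = 0 := by
    intro k v
    have hBs : ∀ l, B (lp.single 2 k v) l =
        (t : ℂ) ^ ((l : ℤ) - k) • Matrix.toEuclideanLin (A.entry l k) v := by
      intro l
      rw [hB, Finset.sum_eq_single k]
      · rw [lp.single_apply_self]
      · intro m _ hm
        rw [lp.single_apply_ne _ _ _ hm, map_zero, smul_zero]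
      · intro hk
        rw [Finset.mem_range] at hk
        rw [A.upper_zero l k (by omega)]
        simp
    have hsum : inner ℂ x (B (lp.single 2 k v)) = ∑ l ∈ Finset.range (k + s + 1),
        (t : ℂ) ^ (-(k : ℤ)) *
          inner ℂ c (Matrix.toEuclideanLin (A.QplusVal j l z * A.entry l k) v) := by
      rw [lp.inner_eq_tsum, tsum_eq_sum (s := Finset.range (k + s + 1))]
      · refine Finset.sum_congr rfl fun l _ => ?_
        rw [hBs, hx, map_smul, inner_smul_right, ← mul_assoc, ← zpow_add₀ htC,
          Matrix.toLpLin_mul_same]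
        congr 2
        ring
      · intro l hl
        rw [Finset.mem_range] at hl
        rw [hBs, A.lower_zero l k (by omega)]
        simp
    rw [algebraMap_sub_apply, inner_sub_right, sub_eq_zero, hsum, inner_smul_right,
      lp.inner_single_right, hx,
      ← Finset.mul_sum, ← inner_sum, ← LinearMap.sum_apply, ← map_sum, A.QplusVal_rec, map_smul,
      LinearMap.smul_apply, inner_smul_right]
    ring
  have hx0 : x = 0 := by
    have hker : ContinuousLinearMap.adjoint (algebraMap ℂ (L2N N →L[ℂ] L2N N) z - B) x = 0 := by
      apply lp.ext
      funext k
      refine ext_inner_right ℂ fun v => ?_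
      rw [← lp.inner_single_right, ContinuousLinearMap.adjoint_inner_left, horth]
      simp
    exact eq_zero_of_isUnit_adjoint hunit hker
  have h1 := hx j c
  rw [hx0, QplusVal_init A j j z j.2, if_pos rfl] at h1
  have h2 : inner ℂ c c = (0 : ℂ) := by
    simpa [htC] using h1
  exact hc (inner_self_eq_zero.1 h2)

end BandMatrix

theorem theorem2 {N r s : ℕ} (hN : 1 ≤ N) (hr : 1 ≤ r) (hs : 1 ≤ s) (A : BandMatrix N r s)
    (ν : Seminorm ℂ (Matrix (Fin N) (Fin N) ℂ)) (hν : ∀ M, ν M = 0 → M = 0)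
    (hA : ∃ C : ℝ, ∀ k l, ν (A.entry k l) ≤ C)
    (z : ℂ) (hz : z ∈ resolventSet ℂ (A.operator ν hν hA)) :
    (∀ i : Fin r, 1 < Filter.limsup
      (fun k : ℕ => ENNReal.ofReal (ν (A.Qval i k z)) ^ (1 / (k : ℝ))) Filter.atTop) ∧
    (∀ j : Fin s, 1 < Filter.limsup
      (fun k : ℕ => ENNReal.ofReal (ν (A.QplusVal j k z)) ^ (1 / (k : ℝ))) Filter.atTop) := by
  exact ⟨fun i => A.one_lt_limsup_Qval hN hr hs ν hν hA z hz i,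
    fun j => A.one_lt_limsup_QplusVal hN hr hs ν hν hA z hz j⟩
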